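/- **Terms.** The $\lambda C$-terms are the terms built from $\lambda$-variables and one constant $C$ by application $(t)u$ and abstraction $\lambda x\,t$, up to renaming of bound variables; $(t)u_1\dots u_n$ stands for $(\dots((t)u_1)\dots)u_n$. Head $C$-reduction $\succ_C$ is the reflexive transitive closure of the following two rules, applied to the whole term, for all $n\ge 0$ and all $\lambda C$-terms $u,t,t_1,\dots,t_n$: 1. $(\lambda x\,u)\,t\,t_1\dots t_n \to (u[t/x])\,t_1\dots t_n$; 2. $(C)\,t\,t_1\dots t_n \to (t)\,\lambda x\,(x)\,t_1\dots t_n$, where $x$ does not occur in $t_1,\dots,t_n$. **Types.** Fix a first-order language (function and predicate symbols with arities) and a set $E$ of equations between its terms, whose variables are understood as universally quantified; write $u\approx v$ if $u=v$ is a consequence of $E$. Types are the second-order formulas built from $\perp$ and atomic formulas by $\to$ and $\forall$, with individual variables $x$ and, for every arity $n$, countably many ordinary $n$-ary predicate variables $X$ and countably many $n$-ary *classical* predicate variables $X_C$; all three sorts of variables may be quantified. Write $\neg A$ for $A\to\perp$. A formula is a *classical type* if it ends with $\perp$ or with a classical variable; that is, the classical types form the least set of formulas that contains $\perp$ and every atomic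 formula $X_C(t_1,\dots,t_n)$, and contains $A\to B$ (for every $A$) and $\forall v\,B$ (for every variable $v$ of any sort) whenever it contains $B$. **Typing.** The judgments $\Gamma\vdash_{M2}t:A$, with $\Gamma=x_1:A_1,\dots,x_n:A_n$ a context, are generated by the rules: - $\Gamma\vdash C:\forall X_C\{\neg\neg X_C\to X_C\}$, where $X_C$ has arity $0$; and $\Gamma\vdash x_i:A_i$; - if $\Gamma,x:A\vdash t:B$, then $\Gamma\vdash\lambda x\,t:A\to B$; if $\Gamma\vdash u:A\to B$ and $\Gamma\vdash v:A$, then $\Gamma\vdash(u)v:B$; - if $\Gamma\vdash t:A$ and the variable $v$ (individual, ordinary predicate or classical) is not free in $\Gamma$, then $\Gamma\vdash t:\forall v\,A$; - if $\Gamma\vdash t:\forall x\,A$, then $\Gamma\vdash t:A[u/x]$ for every term $u$ of the language; - if $\Gamma\vdash t:\forall X\,A$, then $\Gamma\vdash t:A[G/X]$ for every formula $G$; - if $\Gamma\vdash t:\forall X_C\,A$, then $\Gamma\vdash t:A[G/X_C]$ for every classical type $G$; - if $\Gamma\vdash t:A[u/x]$ and $u\approx v$, then $\Gamma\vdash t:A[v/x]$.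 (When $X$ or $X_C$ is $n$-ary, $G$ comes with $n$ distinguished individual variables, which are replaced by the arguments of the predicate variable; all substitutions avoid capture.) **Theorem 7.1.** Let $T$ be a $\lambda C$-term such that $\vdash_{M2}T:\forall X_C\{\perp\to X_C\}$ in the empty context, where $X_C$ has arity $0$. Then for every integer $n\ge 0$ and all $\lambda C$-terms $t,t_1,\dots,t_n$, $$(T)\,t\,t_1\dots t_n\succ_C t.$$ -/

import Mathlib

universe u v

namespace MixedLogic

/-! ### Untyped terms with the control constant, and head reduction

Bound variables are represented by de Bruijn indices throughout, so that terms (and types) are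
taken up to renaming of bound variables. -/

/-- Lambda-terms over one constant `C`. -/
inductive LambdaC : Type
  | var (i : ℕ) : LambdaC
  | app (t u : LambdaC) : LambdaC
  | lam (t : LambdaC) : LambdaC
  | C : LambdaC

namespace LambdaC

/-- Extension of a renaming under a binder. -/
def liftRen (ρ : ℕ → ℕ) : ℕ → ℕ
  | 0 => 0
  | i + 1 => ρ i + 1

def rename : LambdaC → (ℕ → ℕ) → LambdaC
  | var i, ρ => var (ρ i)
  | app t u, ρ => app (t.rename ρ) (u.rename ρ)
  | lam t, ρ => lam (t.rename (liftRen ρ))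
  | C, _ => C

/-- Weakening by one fresh variable, which gets index `0`. -/
def shift (t : LambdaC) : LambdaC := t.rename Nat.succ

/-- Extension of a substitution under a binder. -/
def liftSubst (σ : ℕ → LambdaC) : ℕ → LambdaC
  | 0 => var 0
  | i + 1 => (σ i).shift

/-- Simultaneous capture-avoiding substitution. -/
def subst : LambdaC → (ℕ → LambdaC) → LambdaC
  | var i, σ => σ i
  | app t u, σ => app (t.subst σ) (u.subst σ)
  | lam t, σ => lam (t.subst (liftSubst σ))
  | C, _ => C

/-- The substitution replacing variable `0` by `t` and lowering the other variables. -/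
def single (t : LambdaC) : ℕ → LambdaC
  | 0 => t
  | i + 1 => var i

/-- `u[t/x]`, where `x` is the variable with index `0` in `u`. -/
def inst (u t : LambdaC) : LambdaC := u.subst (single t)

/-- `(t) t₁ … tₙ = (…((t) t₁)…) tₙ`. -/
def apps (t : LambdaC) (ts : List LambdaC) : LambdaC := ts.foldl app t

end LambdaC

open LambdaC in
/-- One step of head `C`-reduction. -/
inductive HeadStep : LambdaC → LambdaC → Prop
  /-- `(λx u) t t₁ … tₙ → (u[t/x]) t₁ … tₙ` -/
  | beta (u t : LambdaC) (ts : List LambdaC) :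
      HeadStep (apps (app (lam u) t) ts) (apps (u.inst t) ts)
  /-- `(C) t t₁ … tₙ → (t) λx (x) t₁ … tₙ`, where `x` does not occur in `t₁, …, tₙ` -/
  | control (t : LambdaC) (ts : List LambdaC) :
      HeadStep (apps (app C t) ts) (app t (lam (apps (var 0) (ts.map shift))))

/-- `t ≻_C t'`: finitely many (possibly zero) steps of head `C`-reduction. -/
def HeadRed : LambdaC → LambdaC → Prop := Relation.ReflTransGen HeadStep

/-! ### Types: second order formulas with ordinary and classical predicate variables -/

/-- The two kinds of predicate variables. -/
inductive Kind : Type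
  | ordinary : Kind
  | classical : Kind
  deriving DecidableEq

/-- Second order formulas over the language `L`. Individual variables, and for every kind and
every arity the predicate variables of that kind and arity, are numbered by separate de Bruijn
indices. -/
inductive Formula (L : FirstOrder.Language.{u, v}) : Type (max u v)
  /-- absurdity -/
  | bot : Formula L
  /-- an atomic formula on a predicate symbol -/
  | rel {n : ℕ} (R : L.Relations n) (ts : Fin n → L.Term ℕ) : Formula L
  /-- an atomic formula on the `i`-th `n`-ary predicate variable of kind `k` -/
  | pvar (k : Kind) (n : ℕ) (i : ℕ) (ts : Fin n → L.Term ℕ) : Formula L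
  | imp (A B : Formula L) : Formula L
  /-- `∀x A`; binds individual variable `0` -/
  | all (A : Formula L) : Formula L
  /-- `∀X A`, resp. `∀X_C A`; binds the `n`-ary predicate variable `0` of kind `k` -/
  | pall (k : Kind) (n : ℕ) (A : Formula L) : Formula L

namespace Formula

variable {L : FirstOrder.Language.{u, v}}

def neg (A : Formula L) : Formula L := imp A bot

/-! #### Substitution of terms for individual variables -/

/-- Extension of an individual substitution under `∀x`. -/
def liftSubst (σ : ℕ → L.Term ℕ) : ℕ → L.Term ℕ
  | 0 => FirstOrder.Language.Term.var 0
  | i + 1 => (σ i).relabel Nat.succ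

def subst : Formula L → (ℕ → L.Term ℕ) → Formula L
  | bot, _ => bot
  | rel R ts, σ => rel R fun j => (ts j).subst σ
  | pvar k n i ts, σ => pvar k n i fun j => (ts j).subst σ
  | imp A B, σ => imp (A.subst σ) (B.subst σ)
  | all A, σ => all (A.subst (liftSubst σ))
  | pall k n A, σ => pall k n (A.subst σ)

/-- The substitution replacing individual variable `0` by `u` and lowering the others. -/
def single (u : L.Term ℕ) : ℕ → L.Term ℕ
  | 0 => u
  | i + 1 => FirstOrder.Language.Term.var i

/-- `A[u/x]`, where `x` is individual variable `0` of `A`. -/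
def inst (A : Formula L) (u : L.Term ℕ) : Formula L := A.subst (single u)

/-- Weakening by one fresh individual variable, which gets index `0`. -/
def shift (A : Formula L) : Formula L := A.subst fun i => FirstOrder.Language.Term.var (i + 1)

/-! #### Renaming of predicate variables -/

/-- Extension of a renaming of predicate variables under a quantifier on a variable of kind `k`
and arity `n`. -/
def liftPRen (k : Kind) (n : ℕ) (ρ : Kind → ℕ → ℕ → ℕ) : Kind → ℕ → ℕ → ℕ := fun k' n' i =>
  if k' = k ∧ n' = n then
    match i with
    | 0 => 0
    | j + 1 => ρ k' n' j + 1
  else ρ k' n' i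

def prename : Formula L → (Kind → ℕ → ℕ → ℕ) → Formula L
  | bot, _ => bot
  | rel R ts, _ => rel R ts
  | pvar k n i ts, ρ => pvar k n (ρ k n i) ts
  | imp A B, ρ => imp (A.prename ρ) (B.prename ρ)
  | all A, ρ => all (A.prename ρ)
  | pall k n A, ρ => pall k n (A.prename (liftPRen k n ρ))

/-- Weakening by one fresh predicate variable of kind `k` and arity `n`, which gets index `0`. -/
def pshift (k : Kind) (n : ℕ) (A : Formula L) : Formula L :=
  A.prename fun k' n' i => if k' = k ∧ n' = n then i + 1 else i

/-! #### Substitution of formulas for predicate variables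

A formula `G` to be substituted for an `n`-ary predicate variable has `n` distinguished individual
variables, namely those with indices `0, …, n - 1`; index `n + i` stands for the individual
variable `i` of the surrounding formula. -/

/-- Replaces the `n` distinguished variables by `ts`. -/
def args {n : ℕ} (ts : Fin n → L.Term ℕ) : ℕ → L.Term ℕ := fun i =>
  if h : i < n then ts ⟨i, h⟩ else FirstOrder.Language.Term.var (i - n)

/-- Weakening by one fresh individual variable of a formula with `n` distinguished variables. -/
def shiftAbove (n : ℕ) (G : Formula L) : Formula L :=
  G.subst fun i => FirstOrder.Language.Term.var (if i < n then i else i + 1)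

/-- The predicate variable `X`, as the formula `X(x₀, …, x_{n-1})` in `n` distinguished
variables. -/
def generic (k : Kind) (n i : ℕ) : Formula L :=
  pvar k n i fun j => FirstOrder.Language.Term.var (j : ℕ)

/-- Extension of a substitution for predicate variables under a quantifier on a predicate variable
of kind `k` and arity `n`. -/
def liftPSubst (k : Kind) (n : ℕ) (θ : Kind → ℕ → ℕ → Formula L) :
    Kind → ℕ → ℕ → Formula L := fun k' n' i =>
  if k' = k ∧ n' = n then
    match i with
    | 0 => generic k' n' 0
    | j + 1 => (θ k' n' j).pshift k n
  else (θ k' n' i).pshift k n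

/-- Simultaneous capture-avoiding substitution of formulas for predicate variables. -/
def psubst : Formula L → (Kind → ℕ → ℕ → Formula L) → Formula L
  | bot, _ => bot
  | rel R ts, _ => rel R ts
  | pvar k n i ts, θ => (θ k n i).subst (args ts)
  | imp A B, θ => imp (A.psubst θ) (B.psubst θ)
  | all A, θ => all (A.psubst fun k n i => (θ k n i).shiftAbove n)
  | pall k n A, θ => pall k n (A.psubst (liftPSubst k n θ))

/-- The substitution replacing the predicate variable `0` of kind `k` and arity `n` by `G` and
lowering the other predicate variables of that kind and arity. -/
def psingle (k : Kind) (n : ℕ) (G : Formula L) : Kind → ℕ → ℕ → Formula L := fun k' n' i =>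
  if k' = k ∧ n' = n then
    match i with
    | 0 => G
    | j + 1 => generic k' n' j
  else generic k' n' i

/-- `A[G/X]`, where `X` is the `n`-ary predicate variable `0` of kind `k` of `A`, and
`G` has `n` distinguished individual variables. -/
def pinst (k : Kind) (n : ℕ) (A G : Formula L) : Formula L := A.psubst (psingle k n G)

/-- Classical types: the formulas that end with `⊥` or with a classical variable. -/
inductive IsClassical : Formula L → Prop
  | bot : IsClassical bot
  | pvar (n i : ℕ) (ts : Fin n → L.Term ℕ) : IsClassical (pvar Kind.classical n i ts)
  | imp (A : Formula L) {B : Formula L} (hB : IsClassical B) : IsClassical (imp A B)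
  | all {A : Formula L} (hA : IsClassical A) : IsClassical (all A)
  | pall (k : Kind) (n : ℕ) {A : Formula L} (hA : IsClassical A) : IsClassical (pall k n A)

end Formula

/-- `u ≈ v`: the equation `u = v` is a consequence of the set of equations `E`, the variables in
the equations of `E` being understood as universally quantified. -/
inductive EqConseq {L : FirstOrder.Language.{u, v}} (E : Set (L.Term ℕ × L.Term ℕ)) :
    L.Term ℕ → L.Term ℕ → Prop
  | ax {a b : L.Term ℕ} (h : (a, b) ∈ E) (σ : ℕ → L.Term ℕ) : EqConseq E (a.subst σ) (b.subst σ)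
  | refl (a : L.Term ℕ) : EqConseq E a a
  | symm {a b : L.Term ℕ} (h : EqConseq E a b) : EqConseq E b a
  | trans {a b c : L.Term ℕ} (hab : EqConseq E a b) (hbc : EqConseq E b c) : EqConseq E a c
  | func {n : ℕ} (f : L.Functions n) {as bs : Fin n → L.Term ℕ}
      (h : ∀ j, EqConseq E (as j) (bs j)) :
      EqConseq E (FirstOrder.Language.Term.func f as) (FirstOrder.Language.Term.func f bs)

/-! ### The type system -/

/-- The type `∀X_C {¬¬X_C → X_C}` of the constant `C`. -/
def typeC (L : FirstOrder.Language.{u, v}) : Formula L :=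
  let X : Formula L := Formula.pvar Kind.classical 0 0 Fin.elim0
  Formula.pall Kind.classical 0 (Formula.imp (Formula.neg (Formula.neg X)) X)

/-- The type `∀X_C {⊥ → X_C}`. -/
def typeAbort (L : FirstOrder.Language.{u, v}) : Formula L :=
  let X : Formula L := Formula.pvar Kind.classical 0 0 Fin.elim0
  Formula.pall Kind.classical 0 (Formula.imp Formula.bot X)

/-- `M2 E Γ t A`: the judgment `Γ ⊢_{M2} t : A` with respect to the set of equations `E`.
The `i`-th entry of `Γ` is the type declared for the variable `i`. -/
inductive M2 {L : FirstOrder.Language.{u, v}} (E : Set (L.Term ℕ × L.Term ℕ)) :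
    List (Formula L) → LambdaC → Formula L → Prop
  | const (Γ : List (Formula L)) : M2 E Γ LambdaC.C (typeC L)
  | var {Γ : List (Formula L)} {i : ℕ} {A : Formula L} (h : Γ[i]? = some A) :
      M2 E Γ (LambdaC.var i) A
  | lam {Γ : List (Formula L)} {t : LambdaC} {A B : Formula L} (h : M2 E (A :: Γ) t B) :
      M2 E Γ (LambdaC.lam t) (Formula.imp A B)
  | app {Γ : List (Formula L)} {t u : LambdaC} {A B : Formula L}
      (ht : M2 E Γ t (Formula.imp A B)) (hu : M2 E Γ u A) : M2 E Γ (LambdaC.app t u) B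
  /-- introduction of `∀x`: weakening the context makes the variable `x` fresh for it -/
  | allIntro {Γ : List (Formula L)} {t : LambdaC} {A : Formula L}
      (h : M2 E (Γ.map Formula.shift) t A) : M2 E Γ t (Formula.all A)
  | allElim {Γ : List (Formula L)} {t : LambdaC} {A : Formula L}
      (h : M2 E Γ t (Formula.all A)) (a : L.Term ℕ) : M2 E Γ t (A.inst a)
  /-- introduction of `∀X` and of `∀X_C`, the variable being fresh for the context -/
  | pallIntro {Γ : List (Formula L)} {t : LambdaC} {k : Kind} {n : ℕ} {A : Formula L}
      (h : M2 E (Γ.map (Formula.pshift k n)) t A) : M2 E Γ t (Formula.pall k n A)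
  /-- elimination of `∀X`, for every formula `G` -/
  | pallElim {Γ : List (Formula L)} {t : LambdaC} {n : ℕ} {A : Formula L}
      (h : M2 E Γ t (Formula.pall Kind.ordinary n A)) (G : Formula L) :
      M2 E Γ t (A.pinst Kind.ordinary n G)
  /-- elimination of `∀X_C`, for every classical type `G` -/
  | pallElimC {Γ : List (Formula L)} {t : LambdaC} {n : ℕ} {A : Formula L}
      (h : M2 E Γ t (Formula.pall Kind.classical n A)) (G : Formula L) (hG : G.IsClassical) :
      M2 E Γ t (A.pinst Kind.classical n G)
  /-- replacement of a term by an equal one -/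
  | eq {Γ : List (Formula L)} {t : LambdaC} {A : Formula L} {a b : L.Term ℕ}
      (h : M2 E Γ t (A.inst a)) (hab : EqConseq E a b) : M2 E Γ t (A.inst b)

end MixedLogic

/-! The proof is a realizability argument. Fix a *pole*: a set `P` of terms closed under head
`C`-expansion. A formula `A` is interpreted as a set `interp P η A` of terms: `⊥` as `P`,
implication and quantifiers in the usual way, where an ordinary predicate variable ranges over all
sets closed under head `β`-expansion, and a classical one only over the sets
`orth P X = {t | ∀ π ∈ X, (t) π ∈ P}` for sets `X` of stacks (lists of terms). The conclusion is
about untyped terms only, so the domain of individuals may be taken to be a single point: then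
every equation holds, a predicate variable of any arity denotes one set of terms, and substitution
of individual terms does not change the interpretation.

Classical types denote sets of the form `orth P X` (`IsClassical.interp`), which justifies the
elimination rule for classical quantifiers. The constant `C` belongs to the denotation of its type
(`C_mem_interp_typeC`) because `(C) v π` steps to `(v) λx (x) π`, and `λx (x) π` sends `orth P X`
into `P` when `π ∈ X`. Hence every typable term, closed by realizers of its context, belongs to
the denotation of its type (`M2.adequacy`).

For the theorem take `P = {u | u ≻_C t}` and instantiate the type variable with
`orth P {t₁ … tₙ}`: as `t ∈ P`, the term `(T) t` belongs to this set, i.e. `(T) t t₁ … tₙ ≻_C t`.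
-/

namespace MixedLogic

/-! ### Substitution calculus of untyped terms -/

namespace LambdaC

theorem rename_rename (t : LambdaC) (ρ ρ' : ℕ → ℕ) :
    (t.rename ρ).rename ρ' = t.rename (fun i => ρ' (ρ i)) := by
  induction t generalizing ρ ρ' with
  | var i => rfl
  | C => rfl
  | app t u iht ihu => simp only [rename, iht, ihu]
  | lam t ih =>
    simp only [rename, ih]
    congr 2
    funext i
    cases i <;> rfl

theorem subst_rename_left (t : LambdaC) (ρ : ℕ → ℕ) (σ : ℕ → LambdaC) :
    (t.rename ρ).subst σ = t.subst (fun i => σ (ρ i)) := by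
  induction t generalizing ρ σ with
  | var i => rfl
  | C => rfl
  | app t u iht ihu => simp only [rename, subst, iht, ihu]
  | lam t ih =>
    simp only [rename, subst, ih]
    congr 2
    funext i
    cases i <;> rfl

theorem rename_subst (t : LambdaC) (σ : ℕ → LambdaC) (ρ : ℕ → ℕ) :
    (t.subst σ).rename ρ = t.subst (fun i => (σ i).rename ρ) := by
  induction t generalizing σ ρ with
  | var i => rfl
  | C => rfl
  | app t u iht ihu => simp only [rename, subst, iht, ihu]
  | lam t ih =>
    simp only [rename, subst, ih]
    congr 2
    funext i
    cases i with
    | zero => rfl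
    | succ i => simp only [liftSubst, shift, rename_rename, liftRen]

theorem subst_subst (t : LambdaC) (σ τ : ℕ → LambdaC) :
    (t.subst σ).subst τ = t.subst (fun i => (σ i).subst τ) := by
  induction t generalizing σ τ with
  | var i => rfl
  | C => rfl
  | app t u iht ihu => simp only [subst, iht, ihu]
  | lam t ih =>
    simp only [subst, ih]
    congr 2
    funext i
    cases i with
    | zero => rfl
    | succ i => simp only [liftSubst, shift, subst_rename_left, rename_subst]

theorem subst_var (t : LambdaC) : t.subst var = t := by
  induction t with
  | var i => rfl
  | C => rfl
  | app t u iht ihu => simp only [subst, iht, ihu]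
  | lam t ih =>
    have h : liftSubst var = var := by
      funext i
      cases i <;> rfl
    simp only [subst, h, ih]

theorem shift_inst (t u : LambdaC) : t.shift.inst u = t := by
  simp only [shift, inst, subst_rename_left, single, subst_var]

/-- The substitution sending variable `0` to `u` and variable `i + 1` to `σ i`. -/
def cons (u : LambdaC) (σ : ℕ → LambdaC) : ℕ → LambdaC
  | 0 => u
  | i + 1 => σ i

theorem subst_liftSubst_inst (t u : LambdaC) (σ : ℕ → LambdaC) :
    (t.subst (liftSubst σ)).inst u = t.subst (cons u σ) := by
  simp only [inst, subst_subst]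
  congr 1
  funext i
  cases i with
  | zero => rfl
  | succ i => exact shift_inst (σ i) u

theorem apps_append (t : LambdaC) (ts us : List LambdaC) :
    apps t (ts ++ us) = apps (apps t ts) us := List.foldl_append

theorem app_apps (t : LambdaC) (ts : List LambdaC) (u : LambdaC) :
    app (apps t ts) u = apps t (ts ++ [u]) := (apps_append t ts [u]).symm

theorem apps_inst (t : LambdaC) (ts : List LambdaC) (u : LambdaC) :
    (apps t ts).inst u = apps (t.inst u) (ts.map (inst · u)) := by
  induction ts generalizing t with
  | nil => rfl
  | cons s ts ih => exact ih (app t s)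

end LambdaC

open LambdaC

/-! ### Saturated sets and orthogonals -/

/-- A set of terms closed under head `β`-expansion. -/
def Saturated (S : Set LambdaC) : Prop :=
  ∀ (u t : LambdaC) (ts : List LambdaC),
    apps (u.inst t) ts ∈ S → apps (app (lam u) t) ts ∈ S

/-- A set of terms closed under expansion along both rules of head `C`-reduction. -/
def IsPole (P : Set LambdaC) : Prop :=
  ∀ u v : LambdaC, HeadStep u v → v ∈ P → u ∈ P

/-- The terms that any stack of `X` brings into `P`. -/
def orth (P : Set LambdaC) (X : Set (List LambdaC)) : Set LambdaC :=
  {t | ∀ π ∈ X, apps t π ∈ P}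

/-- The sets over which predicate variables of a given kind range. -/
def Admissible (P : Set LambdaC) : Kind → Set LambdaC → Prop
  | Kind.ordinary, S => Saturated S
  | Kind.classical, S => ∃ X, S = orth P X

variable {P : Set LambdaC}

theorem IsPole.saturated_orth (hP : IsPole P) (X : Set (List LambdaC)) :
    Saturated (orth P X) := by
  intro u t ts h π hπ
  have h' := h π hπ
  rw [← apps_append] at h' ⊢
  exact hP _ _ (HeadStep.beta u t (ts ++ π)) h'

theorem orth_singleton_nil (P : Set LambdaC) : orth P {[]} = P := by
  ext t
  simp [orth, apps]

theorem Admissible.saturated (hP : IsPole P) {k : Kind} {S : Set LambdaC}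
    (h : Admissible P k S) : Saturated S := by
  cases k with
  | ordinary => exact h
  | classical =>
    obtain ⟨X, rfl⟩ := h
    exact hP.saturated_orth X

/-! ### Interpretation of formulas -/

/-- Assignments of a set of terms to every predicate variable. As there is only one individual,
the denotation of a predicate variable does not depend on arguments. -/
abbrev Assignment : Type := Kind → ℕ → ℕ → Set LambdaC

/-- The assignment for the scope of a quantifier over a predicate variable of kind `k` and arity
`n` that takes the value `S`. -/
def Assignment.extend (k : Kind) (n : ℕ) (S : Set LambdaC) (η : Assignment) : Assignment :=
  fun k' n' i =>
    if k' = k ∧ n' = n then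
      match i with
      | 0 => S
      | j + 1 => η k' n' j
    else η k' n' i

/-- Every predicate variable is assigned a set within the range of its kind. -/
def Assignment.Valid (P : Set LambdaC) (η : Assignment) : Prop :=
  ∀ k n i, Admissible P k (η k n i)

theorem Assignment.Valid.extend {η : Assignment} (hη : η.Valid P) {k : Kind} (n : ℕ)
    {S : Set LambdaC} (hS : Admissible P k S) : (Assignment.extend k n S η).Valid P := by
  intro k' n' i
  unfold Assignment.extend
  split_ifs with h
  · obtain ⟨rfl, rfl⟩ := h
    cases i with
    | zero => exact hS
    | succ j => exact hη _ _ j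
  · exact hη _ _ i

namespace Formula

variable {L : FirstOrder.Language.{u, v}}

/-- The set of realizers of a formula, for the pole `P`, over a one-point domain of individuals.
Predicate symbols of the language are interpreted by the set of all terms. -/
def interp (P : Set LambdaC) : Assignment → Formula L → Set LambdaC
  | _, bot => P
  | _, rel _ _ => Set.univ
  | η, pvar k n i _ => η k n i
  | η, imp A B => {t | ∀ u ∈ interp P η A, LambdaC.app t u ∈ interp P η B}
  | η, all A => interp P η A
  | η, pall k n A => {t | ∀ S, Admissible P k S → t ∈ interp P (Assignment.extend k n S η) A}

theorem interp_subst (η : Assignment) (A : Formula L) (σ : ℕ → L.Term ℕ) :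
    interp P η (A.subst σ) = interp P η A := by
  induction A generalizing η σ with
  | bot => rfl
  | rel R ts => rfl
  | pvar k n i ts => rfl
  | imp A B ihA ihB => simp only [subst, interp, ihA, ihB]
  | all A ih => simp only [subst, interp, ih]
  | pall k n A ih => simp only [subst, interp, ih]

theorem interp_prename (η : Assignment) (A : Formula L) (ρ : Kind → ℕ → ℕ → ℕ) :
    interp P η (A.prename ρ) = interp P (fun k n i => η k n (ρ k n i)) A := by
  induction A generalizing η ρ with
  | bot => rfl
  | rel R ts => rfl
  | pvar k n i ts => rfl
  | imp A B ihA ihB => simp only [prename, interp, ihA, ihB]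
  | all A ih => simp only [prename, interp, ih]
  | pall k n A ih =>
    have h : ∀ S, (fun k' n' i => Assignment.extend k n S η k' n' (liftPRen k n ρ k' n' i)) =
        Assignment.extend k n S fun k' n' i => η k' n' (ρ k' n' i) := by
      intro S
      funext k' n' i
      by_cases hk : k' = k ∧ n' = n
      · cases i <;> simp [Assignment.extend, liftPRen, hk]
      · simp [Assignment.extend, liftPRen, hk]
    simp only [prename, interp, ih, h]

theorem interp_extend_pshift (η : Assignment) (A : Formula L) (k : Kind) (n : ℕ)
    (S : Set LambdaC) :
    interp P (Assignment.extend k n S η) (A.pshift k n) = interp P η A := by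
  rw [pshift, interp_prename]
  congr 1
  funext k' n' i
  by_cases hk : k' = k ∧ n' = n <;> simp [Assignment.extend, hk]

theorem interp_psubst (η : Assignment) (A : Formula L) (θ : Kind → ℕ → ℕ → Formula L) :
    interp P η (A.psubst θ) = interp P (fun k n i => interp P η (θ k n i)) A := by
  induction A generalizing η θ with
  | bot => rfl
  | rel R ts => rfl
  | pvar k n i ts => simp only [psubst, interp, interp_subst]
  | imp A B ihA ihB => simp only [psubst, interp, ihA, ihB]
  | all A ih => simp only [psubst, interp, ih, shiftAbove, interp_subst]
  | pall k n A ih =>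
    have h : ∀ S, (fun k' n' i =>
          interp P (Assignment.extend k n S η) (liftPSubst k n θ k' n' i)) =
        Assignment.extend k n S fun k' n' i => interp P η (θ k' n' i) := by
      intro S
      funext k' n' i
      by_cases hk : k' = k ∧ n' = n
      · obtain ⟨rfl, rfl⟩ := hk
        cases i with
        | zero => simp [Assignment.extend, liftPSubst, generic, interp]
        | succ j =>
          simp only [liftPSubst, and_self, if_true, interp_extend_pshift]
          simp [Assignment.extend]
      · simp only [liftPSubst, hk, if_false, interp_extend_pshift]
        simp [Assignment.extend, hk]
    simp only [psubst, interp, ih, h]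

theorem interp_pinst (η : Assignment) (A G : Formula L) (k : Kind) (n : ℕ) :
    interp P η (A.pinst k n G) =
      interp P (Assignment.extend k n (interp P η G) η) A := by
  rw [pinst, interp_psubst]
  congr 1
  funext k' n' i
  by_cases hk : k' = k ∧ n' = n
  · cases i <;> simp [Assignment.extend, psingle, generic, interp, hk]
  · simp [Assignment.extend, psingle, generic, interp, hk]

theorem saturated_interp (hP : IsPole P) {η : Assignment} (hη : η.Valid P) (A : Formula L) :
    Saturated (interp P η A) := by
  induction A generalizing η with
  | bot => exact orth_singleton_nil P ▸ hP.saturated_orth {[]}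
  | rel R ts => exact fun _ _ _ _ => trivial
  | pvar k n i ts => exact (hη k n i).saturated hP
  | imp A B ihA ihB =>
    intro u t ts h w hw
    have h' := h w hw
    rw [app_apps] at h' ⊢
    exact ihB hη u t _ h'
  | all A ih => exact ih hη
  | pall k n A ih => exact fun u t ts h S hS => ih (hη.extend n hS) u t ts (h S hS)

/-- A classical type denotes the orthogonal of a set of stacks: for an implication, the stacks
formed by a realizer of the premise and a stack of the conclusion; for a quantifier, the union of
the sets of stacks of all instances. -/
theorem IsClassical.interp {A : Formula L} (hA : A.IsClassical) {η : Assignment}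
    (hη : η.Valid P) : ∃ X, A.interp P η = orth P X := by
  induction hA generalizing η with
  | bot => exact ⟨{[]}, (orth_singleton_nil P).symm⟩
  | pvar n i ts => exact hη Kind.classical n i
  | imp A hB ih =>
    obtain ⟨X, hX⟩ := ih hη
    refine ⟨{π | ∃ u ∈ A.interp P η, ∃ π' ∈ X, π = u :: π'}, ?_⟩
    ext t
    simp only [Formula.interp, hX, orth, Set.mem_ofPred_eq]
    constructor
    · rintro h _ ⟨u, hu, π', hπ', rfl⟩
      exact h u hu π' hπ'
    · exact fun h u hu π hπ => h _ ⟨u, hu, π, hπ, rfl⟩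
  | all hA ih => exact ih hη
  | pall k n hA ih =>
    choose X hX using fun S (hS : Admissible P k S) => ih (hη.extend n hS)
    refine ⟨{π | ∃ S, ∃ hS : Admissible P k S, π ∈ X S hS}, ?_⟩
    ext t
    constructor
    · rintro h π ⟨S, hS, hπ⟩
      have h' := h S hS
      rw [hX S hS] at h'
      exact h' π hπ
    · intro h S hS
      rw [hX S hS]
      exact fun π hπ => h π ⟨S, hS, hπ⟩

end Formula

open Formula

/-! ### Adequacy -/

variable {L : FirstOrder.Language.{u, v}}

theorem C_mem_interp_typeC (hP : IsPole P) (η : Assignment) :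
    LambdaC.C ∈ interp P η (typeC L) := by
  rintro S ⟨X, rfl⟩ v hv π hπ
  simp only [neg, interp, Assignment.extend, and_self, if_true, Set.mem_ofPred_eq] at hv
  refine hP _ _ (HeadStep.control v π) (hv _ fun u hu => ?_)
  refine hP _ _ (HeadStep.beta _ u []) ?_
  -- the contractum `((x) π)[u/x]` is `(u) π`
  have h : (apps (var 0) (π.map shift)).inst u = apps u π := by
    rw [apps_inst, List.map_map]
    have hπ' : ((fun s : LambdaC => s.inst u) ∘ shift) = id := funext fun s => shift_inst s u
    rw [hπ', List.map_id]
    rfl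
  change (apps (var 0) (π.map shift)).inst u ∈ P
  rw [h]
  exact hu π hπ

/-- A typable term, instantiated with realizers of the types of its context, realizes its type. -/
theorem M2.adequacy (hP : IsPole P) {E : Set (L.Term ℕ × L.Term ℕ)} {Γ : List (Formula L)}
    {t : LambdaC} {A : Formula L} (h : M2 E Γ t A) {η : Assignment} (hη : η.Valid P)
    (σ : ℕ → LambdaC) (hσ : ∀ i B, Γ[i]? = some B → σ i ∈ interp P η B) :
    t.subst σ ∈ interp P η A := by
  induction h generalizing η σ with
  | const Γ => exact C_mem_interp_typeC hP η
  | var h => exact hσ _ _ h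
  | @lam Γ t A B h ih =>
    intro u hu
    refine saturated_interp hP hη B _ u [] ?_
    change (t.subst (LambdaC.liftSubst σ)).inst u ∈ _
    rw [subst_liftSubst_inst]
    refine ih hη _ fun i D hD => ?_
    cases i with
    | zero =>
      obtain rfl : A = D := by simpa using hD
      exact hu
    | succ i => exact hσ i D (by simpa using hD)
  | app ht hu iht ihu => exact iht hη σ hσ _ (ihu hη σ hσ)
  | allIntro h ih =>
    refine ih hη σ fun i D hD => ?_
    obtain ⟨B, hB, rfl⟩ : ∃ B, _ ∧ Formula.shift B = D := by simpa using hD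
    rw [Formula.shift, interp_subst]
    exact hσ i B hB
  | allElim h a ih =>
    rw [Formula.inst, interp_subst]
    exact ih hη σ hσ
  | @pallIntro Γ t k n A h ih =>
    intro S hS
    refine ih (hη.extend n hS) σ fun i D hD => ?_
    obtain ⟨B, hB, rfl⟩ : ∃ B, _ ∧ Formula.pshift k n B = D := by simpa using hD
    rw [interp_extend_pshift]
    exact hσ i B hB
  | pallElim h G ih =>
    rw [interp_pinst]
    exact ih hη σ hσ _ (saturated_interp hP hη G)
  | pallElimC h G hG ih =>
    rw [interp_pinst]
    exact ih hη σ hσ _ (hG.interp hη)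
  | eq h hab ih =>
    have h' := ih hη σ hσ
    rw [Formula.inst, interp_subst] at h' ⊢
    exact h'

theorem isPole_headRed (t : LambdaC) : IsPole {u | HeadRed u t} :=
  fun _ _ h h' => Relation.ReflTransGen.head h h'

end MixedLogic

open MixedLogic in
theorem theorem7p1 (L : FirstOrder.Language.{u, v}) (E : Set (L.Term ℕ × L.Term ℕ))
    (T : LambdaC) (hT : M2 E [] T (typeAbort L))
    (n : ℕ) (t : LambdaC) (ts : Fin n → LambdaC) :
    HeadRed (LambdaC.apps (LambdaC.app T t) (List.ofFn ts)) t := by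
  have hP := isPole_headRed t
  have hη : Assignment.Valid {u | HeadRed u t} fun _ _ _ => orth {u | HeadRed u t} ∅ := by
    intro k _ _
    cases k with
    | ordinary => exact hP.saturated_orth ∅
    | classical => exact ⟨∅, rfl⟩
  have h := hT.adequacy hP hη LambdaC.var (by simp)
  rw [LambdaC.subst_var] at h
  exact h (orth {u | HeadRed u t} {List.ofFn ts}) ⟨_, rfl⟩ t Relation.ReflTransGen.refl _ rfl
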